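/- Let $n\ge 0$ and let $\mathfrak S_n$ be the set of permutations of $[n]=\{1,\dots,n\}$. For $\sigma\in\mathfrak S_n$ let $$\operatorname{cros}\sigma=\#\{(i,j)\in[n]^2:\ i<j\le\sigma(i)<\sigma(j)\ \text{ or }\ i>j>\sigma(i)>\sigma(j)\},$$ $$\operatorname{nest}\sigma=\#\{(i,j)\in[n]^2:\ i<j\le\sigma(j)<\sigma(i)\ \text{ or }\ i>j>\sigma(j)>\sigma(i)\}.$$ Let $\operatorname{drop}\sigma$ be the number of $i\in[n]$ with $i>\sigma(i)$, and $\operatorname{fix}\sigma$ the number of fixed points. Let $\operatorname{cda}\sigma$, $\operatorname{cdd}\sigma$, $\operatorname{cval}\sigma$ be the numbers of $x\in[n]$ that are, respectively, double excedances ($\sigma^{-1}(x)<x<\sigma(x)$), double drops ($\sigma^{-1}(x)>x>\sigma(x)$), and cyclic valleys ($\sigma^{-1}(x)>x$ and $x<\sigma(x)$). Put $$B_n(p,q,t,u,v,w,y)=\sum_{\sigma\in\mathfrak S_n}p^{\operatorname{nest}\sigma}q^{\operatorname{cros}\sigma}t^{\operatorname{drop}\sigma}u^{\operatorname{cda}\sigma}v^{\operatorname{cdd}\sigma}w^{\operatorname{cval}\sigma}y^{\operatorname{fix}\sigma},$$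 and for $k,j\ge0$ let $b_{n,k,j}(p,q)\in\mathbb Z[p,q]$ be the coefficient of $w^ky^j$ in $B_n(p,q,1,0,1,w,y)$. Set $\sigma(0)=0$ and $\sigma(n+1)=n+1$. For $i\in[n]$, the letter $\sigma(i)$ is a valley if $\sigma(i-1)>\sigma(i)<\sigma(i+1)$, and a double ascent if $\sigma(i-1)<\sigma(i)<\sigma(i+1)$; a foremaximum is a double ascent $\sigma(i)$ such that $\sigma(l)<\sigma(i)$ for all $1\le l<i$. Let $(31\text{-}2)\,\sigma$ be the number of pairs $2\le i<j\le n$ with $\sigma(i-1)>\sigma(j)>\sigma(i)$, and $(2\text{-}31)\,\sigma$ the number of pairs $1\le i<j\le n-1$ with $\sigma(j+1)<\sigma(i)<\sigma(j)$. Then $$B_n(p,q,t,u,v,w,y)=\sum_{j=0}^{n}y^j\sum_{k=0}^{\lfloor (n-j)/2\rfloor}b_{n,k,j}(p,q)\,(tw)^k(qu+tv)^{n-j-2k}.$$ Moreover, for all $k,j\ge 0$, the polynomial $b_{n,k,j}(p,q)$ has nonnegative integer coefficients, and $$b_{n,k,j}(p,q)=\sum_{\sigma\in\mathfrak S_{n,k,j}}p^{\operatorname{nest}\sigma}q^{\operatorname{cros}\sigma}=\sum_{\sigma\in\mathfrak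 S^*_{n,k,j}}p^{(2\text{-}31)\,\sigma}q^{(31\text{-}2)\,\sigma},$$ where $\mathfrak S_{n,k,j}$ is the set of $\sigma\in\mathfrak S_n$ with exactly $k$ cyclic valleys, exactly $j$ fixed points and no double excedance, and $\mathfrak S^*_{n,k,j}$ is the set of $\sigma\in\mathfrak S_n$ with exactly $k$ valleys and exactly $j$ double ascents, all of which are foremaxima. In particular, $b_{n,k,0}(p,q)$ is the first sum taken over the derangements with exactly $k$ cyclic valleys and no double excedance, and the second sum taken over the permutations without foremaximum (coderangements) with exactly $k$ valleys and no double ascent. -/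

import Mathlib

/-!
Permutations of `[n] = {1, …, n}` are elements of `Equiv.Perm (Fin n)`; the letter `i` of `[n]`
is the element `i - 1` of `Fin n`.
-/

namespace PermStat

variable {n : ℕ}

/-- Number of crossings: pairs `(i, j)` with `i < j ≤ σ i < σ j` or `i > j > σ i > σ j`. -/
def cros (σ : Equiv.Perm (Fin n)) : ℕ :=
  (Finset.univ.filter fun x : Fin n × Fin n =>
    (x.1 < x.2 ∧ x.2 ≤ σ x.1 ∧ σ x.1 < σ x.2) ∨
      (x.1 > x.2 ∧ x.2 > σ x.1 ∧ σ x.1 > σ x.2)).card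

/-- Number of nestings: pairs `(i, j)` with `i < j ≤ σ j < σ i` or `i > j > σ j > σ i`. -/
def nest (σ : Equiv.Perm (Fin n)) : ℕ :=
  (Finset.univ.filter fun x : Fin n × Fin n =>
    (x.1 < x.2 ∧ x.2 ≤ σ x.2 ∧ σ x.2 < σ x.1) ∨
      (x.1 > x.2 ∧ x.2 > σ x.2 ∧ σ x.2 > σ x.1)).card

/-- Number of drops. -/
def drop (σ : Equiv.Perm (Fin n)) : ℕ :=
  (Finset.univ.filter fun i : Fin n => i > σ i).card

/-- Number of (cyclic) double excedances. -/
def cda (σ : Equiv.Perm (Fin n)) : ℕ :=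
  (Finset.univ.filter fun x : Fin n => σ.symm x < x ∧ x < σ x).card

/-- Number of (cyclic) double drops. -/
def cdd (σ : Equiv.Perm (Fin n)) : ℕ :=
  (Finset.univ.filter fun x : Fin n => σ.symm x > x ∧ x > σ x).card

/-- Number of cyclic valleys. -/
def cvalley (σ : Equiv.Perm (Fin n)) : ℕ :=
  (Finset.univ.filter fun x : Fin n => σ.symm x > x ∧ x < σ x).card

/-- Number of fixed points. -/
def fix (σ : Equiv.Perm (Fin n)) : ℕ :=
  (Finset.univ.filter fun x : Fin n => σ x = x).card

/-- The word `σ(0) σ(1) … σ(n) σ(n+1)` with letters in `{0, …, n + 1}`, where `σ(0) = 0` and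
`σ(n+1) = n + 1`: `word σ i` is the letter `σ(i)` in one-based numbering. -/
def word (σ : Equiv.Perm (Fin n)) (i : ℕ) : ℕ :=
  if h : 1 ≤ i ∧ i ≤ n then (σ ⟨i - 1, by omega⟩ : ℕ) + 1 else i

/-- The letter at position `i` (one-based) is a valley. -/
def IsValley (σ : Equiv.Perm (Fin n)) (i : ℕ) : Prop :=
  word σ (i - 1) > word σ i ∧ word σ i < word σ (i + 1)

/-- The letter at position `i` (one-based) is a double ascent. -/
def IsDoubleAscent (σ : Equiv.Perm (Fin n)) (i : ℕ) : Prop :=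
  word σ (i - 1) < word σ i ∧ word σ i < word σ (i + 1)

/-- The letter at position `i` (one-based) is a foremaximum: a double ascent that is a
left-to-right maximum. -/
def IsForemaximum (σ : Equiv.Perm (Fin n)) (i : ℕ) : Prop :=
  IsDoubleAscent σ i ∧ ∀ j ∈ Finset.Ico 1 i, word σ j < word σ i

instance (σ : Equiv.Perm (Fin n)) (i : ℕ) : Decidable (IsValley σ i) :=
  inferInstanceAs (Decidable (_ ∧ _))

instance (σ : Equiv.Perm (Fin n)) (i : ℕ) : Decidable (IsDoubleAscent σ i) :=
  inferInstanceAs (Decidable (_ ∧ _))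

instance (σ : Equiv.Perm (Fin n)) (i : ℕ) : Decidable (IsForemaximum σ i) :=
  inferInstanceAs (Decidable (_ ∧ _))

/-- Every double ascent is a foremaximum. -/
def DoubleAscentsAreForemaxima (σ : Equiv.Perm (Fin n)) : Prop :=
  ∀ i ∈ Finset.Icc 1 n, IsDoubleAscent σ i → IsForemaximum σ i

instance (σ : Equiv.Perm (Fin n)) : Decidable (DoubleAscentsAreForemaxima σ) :=
  inferInstanceAs (Decidable (∀ i ∈ Finset.Icc 1 n, IsDoubleAscent σ i → IsForemaximum σ i))

/-- Number of valleys. -/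
def valley (σ : Equiv.Perm (Fin n)) : ℕ := ((Finset.Icc 1 n).filter (IsValley σ)).card

/-- Number of double ascents. -/
def da (σ : Equiv.Perm (Fin n)) : ℕ := ((Finset.Icc 1 n).filter (IsDoubleAscent σ)).card

/-- Number of foremaxima. -/
def fmax (σ : Equiv.Perm (Fin n)) : ℕ := ((Finset.Icc 1 n).filter (IsForemaximum σ)).card

/-- The statistic `(31-2)`: pairs `2 ≤ i < j ≤ n` with `σ(i-1) > σ(j) > σ(i)`. -/
def les (σ : Equiv.Perm (Fin n)) : ℕ :=
  ((Finset.Icc 2 n ×ˢ Finset.Icc 2 n).filter fun x =>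
    x.1 < x.2 ∧ word σ (x.1 - 1) > word σ x.2 ∧ word σ x.2 > word σ x.1).card

/-- The statistic `(2-31)`: pairs `1 ≤ i < j ≤ n - 1` with `σ(j+1) < σ(i) < σ(j)`. -/
def ress (σ : Equiv.Perm (Fin n)) : ℕ :=
  ((Finset.Icc 1 (n - 1) ×ˢ Finset.Icc 1 (n - 1)).filter fun x =>
    x.1 < x.2 ∧ word σ (x.2 + 1) < word σ x.1 ∧ word σ x.1 < word σ x.2).card

/-- Permutations with `k` cyclic valleys, `j` fixed points and no double excedance. -/
def cyclicClass (n k j : ℕ) : Finset (Equiv.Perm (Fin n)) :=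
  Finset.univ.filter fun σ => cvalley σ = k ∧ fix σ = j ∧ cda σ = 0

/-- Permutations with `k` valleys and `j` double ascents, all of which are foremaxima. -/
def linearClass (n k j : ℕ) : Finset (Equiv.Perm (Fin n)) :=
  Finset.univ.filter fun σ => valley σ = k ∧ da σ = j ∧
    DoubleAscentsAreForemaxima σ

open Classical in
/-- Derangements with `k` cyclic valleys and no double excedance. -/
noncomputable def derangementClass (n k : ℕ) : Finset (Equiv.Perm (Fin n)) :=
  Finset.univ.filter fun σ => σ ∈ derangements (Fin n) ∧ cvalley σ = k ∧ cda σ = 0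

/-- Coderangements (no foremaximum) with `k` valleys and no double ascent. -/
def coderangementClass (n k : ℕ) : Finset (Equiv.Perm (Fin n)) :=
  Finset.univ.filter fun σ => fmax σ = 0 ∧ valley σ = k ∧ da σ = 0

/-- The polynomial `B_n(p,q,t,u,v,w,y)`, with its variables taken in an arbitrary commutative
ring (for instance as the indeterminates of a polynomial ring). -/
def B {R : Type*} [CommRing R] (n : ℕ) (p q t u v w y : R) : R :=
  ∑ σ : Equiv.Perm (Fin n),
    p ^ nest σ * q ^ cros σ * t ^ drop σ * u ^ cda σ * v ^ cdd σ * w ^ cvalley σ * y ^ fix σ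

/-- The polynomial `b_{n,k,j}(p,q)` in `ℤ[p,q]` (`p = X 0`, `q = X 1`): the coefficient of
`w^k y^j` in `B_n(p,q,1,0,1,w,y)`, computed in `ℤ[p,q][w][y]`. -/
noncomputable def b (n k j : ℕ) : MvPolynomial (Fin 2) ℤ :=
  ((B n (Polynomial.C (Polynomial.C (MvPolynomial.X 0)))
      (Polynomial.C (Polynomial.C (MvPolynomial.X 1))) 1 0 1
      (Polynomial.C Polynomial.X) Polynomial.X :
    Polynomial (Polynomial (MvPolynomial (Fin 2) ℤ))).coeff j).coeff k

end PermStat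

/-!
Both families of statistics are carried by labelled Motzkin paths. Reading the elements `x` of `[n]`
in increasing order, the number of arcs of `σ` that cross the cut between `x` and `x + 1` is the
height of a path whose step at `x` is given by the cyclic type of `x` and labelled by the numbers of
arcs above the arcs that close at `x`; nestings and crossings can be read off from the labels
(Foata–Zeilberger). Reading instead the letters of the word in increasing order, the number of
descents that cut between the values `x` and `x + 1` is the height, and the label of `x` is the
number of such descents to its left, that is, the number of patterns 31-2 in which `x` is the `2`
(Françon–Viennot). Both codings are injective, and hence bijective, because there are `n!` labelled
paths of either kind.

The `γ`-expansion follows since `t`, `u`, `v`, `w` enter the weighted path sum only through `t * w`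
and `q * u + t * v`. The two combinatorial descriptions of `b` agree since a sum over Motzkin paths
depends on the weights of the steps up from `h` and down from `h + 1` only through their product,
which is `w * [h + 1] ^ 2` for both models.
-/

namespace PermStat

open Finset

section Histories

/-- A device that, in state `s`, reads one of the finitely many letters in `letters s` and moves to
the state given by `next`. The words that lead from `start` to `final` are its histories. -/
structure HistorySystem (S A : Type*) where
  letters : S → Finset A
  next : S → A → S
  start : S
  final : S

namespace HistorySystem

variable {S A R : Type*} (H : HistorySystem S A)

/-- The product of the weights `wt s a` of the letters of a word, where `s` is the state in which
`a` is read. -/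
def wordWeight [Monoid R] (wt : S → A → R) : S → List A → R
  | _, [] => 1
  | s, a :: l => wt s a * wordWeight wt (H.next s a) l

open Classical in
/-- The words of length `n` that lead from the state `s` to the final state. -/
noncomputable def histories : ℕ → S → Finset (List A)
  | 0, s => if s = H.final then {[]} else ∅
  | n + 1, s => (H.letters s).biUnion fun a => (histories n (H.next s a)).image (List.cons a)

/-- The generating function of the words of length `n` that lead from the state `s` to the final
state. -/
noncomputable def totalWeight [Semiring R] (wt : S → A → R) (n : ℕ) (s : S) : R :=
  ∑ l ∈ H.histories n s, H.wordWeight wt s l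

open Classical in
theorem totalWeight_zero [Semiring R] (wt : S → A → R) (s : S) :
    H.totalWeight wt 0 s = if s = H.final then 1 else 0 := by
  by_cases hs : s = H.final <;> simp [totalWeight, histories, wordWeight, hs]

theorem totalWeight_succ [Semiring R] (wt : S → A → R) (n : ℕ) (s : S) :
    H.totalWeight wt (n + 1) s =
      ∑ a ∈ H.letters s, wt s a * H.totalWeight wt n (H.next s a) := by
  classical
  rw [totalWeight, histories, sum_biUnion]
  · refine sum_congr rfl fun a _ => ?_
    rw [sum_image List.cons_injective.injOn, totalWeight, mul_sum]
    rfl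
  · intro a _ b _ hab
    simp only [Function.onFun, disjoint_left, mem_image]
    rintro _ ⟨l, _, rfl⟩ ⟨l', _, h⟩
    exact hab (List.cons.inj h).1.symm

theorem card_histories (n : ℕ) (s : S) :
    #(H.histories n s) = H.totalWeight (fun _ _ => (1 : ℕ)) n s := by
  have wordWeight_one (l : List A) (s : S) : H.wordWeight (fun _ _ => (1 : ℕ)) s l = 1 := by
    induction l generalizing s with
    | nil => rfl
    | cons a l ih => rw [wordWeight, ih, mul_one]
  simp only [totalWeight, wordWeight_one, card_eq_sum_ones]

theorem ofFn_mem_histories {n : ℕ} {letter : Fin n → A} {state : ℕ → S}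
    (hlast : state n = H.final) (hmem : ∀ i : Fin n, letter i ∈ H.letters (state i))
    (hnext : ∀ i : Fin n, state (i + 1) = H.next (state i) (letter i)) :
    List.ofFn letter ∈ H.histories n (state 0) := by
  classical
  induction n generalizing state with
  | zero => simp [histories, hlast]
  | succ n ih =>
    have htail := ih (letter := fun i => letter i.succ) (state := fun i => state (i + 1)) hlast
      (fun i => hmem i.succ) (fun i => hnext i.succ)
    have hfirst : state (0 + 1) = H.next (state 0) (letter 0) := hnext 0
    rw [List.ofFn_succ, histories, mem_biUnion]
    exact ⟨letter 0, hmem 0, mem_image_of_mem _ (hfirst ▸ htail)⟩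

theorem wordWeight_ofFn [CommMonoid R] (wt : S → A → R) {n : ℕ} {letter : Fin n → A}
    {state : ℕ → S} (hnext : ∀ i : Fin n, state (i + 1) = H.next (state i) (letter i)) :
    H.wordWeight wt (state 0) (List.ofFn letter) = ∏ i : Fin n, wt (state i) (letter i) := by
  induction n generalizing state with
  | zero => simp [wordWeight]
  | succ n ih =>
    have htail := ih (letter := fun i => letter i.succ) (state := fun i => state (i + 1))
      (fun i => hnext i.succ)
    have hfirst : state (0 + 1) = H.next (state 0) (letter 0) := hnext 0
    rw [List.ofFn_succ, wordWeight, Fin.prod_univ_succ, ← hfirst]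
    exact congrArg _ htail

/-- An injective coding of the elements of `X` by histories of length `n`: the letter
`letter x i` is read in the state `state x i`. -/
structure Coding (X : Type*) (n : ℕ) where
  letter : X → Fin n → A
  state : X → ℕ → S
  state_zero : ∀ x, state x 0 = H.start
  state_last : ∀ x, state x n = H.final
  letter_mem : ∀ x (i : Fin n), letter x i ∈ H.letters (state x i)
  state_succ : ∀ x (i : Fin n), state x (i + 1) = H.next (state x i) (letter x i)
  letter_injective : Function.Injective letter

variable {H}

theorem Coding.sum_prod_eq_totalWeight [CommSemiring R] {X : Type*} [Fintype X] {n : ℕ}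
    (c : H.Coding X n) (wt : S → A → R)
    (hcard : H.totalWeight (fun _ _ => (1 : ℕ)) n H.start ≤ Fintype.card X) :
    ∑ x, ∏ i : Fin n, wt (c.state x i) (c.letter x i) = H.totalWeight wt n H.start := by
  classical
  have hinj : Function.Injective fun x => List.ofFn (c.letter x) :=
    List.ofFn_injective.comp c.letter_injective
  have hsurj : univ.image (fun x => List.ofFn (c.letter x)) = H.histories n H.start := by
    refine eq_of_subset_of_card_le (image_subset_iff.2 fun x _ => ?_) ?_
    · exact c.state_zero x ▸
        H.ofFn_mem_histories (c.state_last x) (c.letter_mem x) (c.state_succ x)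
    · rwa [card_histories, card_image_of_injective _ hinj, card_univ]
  rw [totalWeight, ← hsurj, sum_image hinj.injOn]
  exact sum_congr rfl fun x _ => c.state_zero x ▸ (H.wordWeight_ofFn wt (c.state_succ x)).symm

end HistorySystem

end Histories

section Motzkin

variable {R : Type*}

/-- The weighted sum over Motzkin paths of length `n` from height `h` to height `0`, where the
steps up, level and down starting at height `h` have weights `a h`, `b h` and `c h`. -/
def motzkinSum [Semiring R] (a b c : ℕ → R) : ℕ → ℕ → R
  | 0, 0 => 1
  | 0, _ + 1 => 0
  | n + 1, 0 => a 0 * motzkinSum a b c n 1 + b 0 * motzkinSum a b c n 0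
  | n + 1, h + 1 => a (h + 1) * motzkinSum a b c n (h + 2) +
      b (h + 1) * motzkinSum a b c n (h + 1) + c (h + 1) * motzkinSum a b c n h

theorem motzkinSum_eq_prod_mul [CommSemiring R] (a b c : ℕ → R) (n h : ℕ) :
    motzkinSum a b c n h = (∏ i ∈ range h, c (i + 1)) *
      motzkinSum (fun h => a h * c (h + 1)) b (fun _ => 1) n h := by
  induction n generalizing h with
  | zero => cases h <;> simp [motzkinSum]
  | succ n ih =>
    cases h with
    | zero => simp only [motzkinSum, ih, prod_range_succ, prod_range_zero]; ring
    | succ h => simp only [motzkinSum, ih, prod_range_succ]; ring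

/-- In a path from height `0` to height `0`, every step up from `h` is matched by a step down from
`h + 1`. -/
theorem motzkinSum_zero_congr [CommSemiring R] {a a' c c' : ℕ → R} (b : ℕ → R)
    (h : ∀ h, a h * c (h + 1) = a' h * c' (h + 1)) (n : ℕ) :
    motzkinSum a b c n 0 = motzkinSum a' b c' n 0 := by
  rw [motzkinSum_eq_prod_mul a, motzkinSum_eq_prod_mul a', funext h, prod_range_zero,
    prod_range_zero]

theorem motzkinSum_factorial (n h : ℕ) :
    motzkinSum (· + 1) (2 * · + 1) (fun h => h) n h = n.factorial * n.choose h := by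
  induction n generalizing h with
  | zero => cases h <;> simp [motzkinSum]
  | succ n ih =>
    cases h with
    | zero =>
      simp only [motzkinSum, ih, Nat.factorial_succ, zero_add, Nat.choose_zero_right,
        Nat.choose_one_right]
      ring
    | succ h =>
      have hlow := Nat.add_one_mul_choose_eq n h
      have hhigh := Nat.add_one_mul_choose_eq n (h + 1)
      rw [Nat.choose_succ_succ'] at hlow hhigh
      simp only [motzkinSum, ih, Nat.factorial_succ, Nat.choose_succ_succ']
      linear_combination n.factorial * (hlow.symm + hhigh.symm)

theorem HistorySystem.totalWeight_eq_motzkinSum {A : Type*} [Semiring R] {H : HistorySystem ℕ A}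
    {wt : ℕ → A → R} {a b c : ℕ → R} (hfinal : H.final = 0) (hc : c 0 = 0)
    (hstep : ∀ h (f : ℕ → R), ∑ x ∈ H.letters h, wt h x * f (H.next h x) =
      a h * f (h + 1) + b h * f h + c h * f (h - 1)) (n h : ℕ) :
    H.totalWeight wt n h = motzkinSum a b c n h := by
  induction n generalizing h with
  | zero => cases h <;> simp [totalWeight_zero, hfinal, motzkinSum]
  | succ n ih =>
    rw [totalWeight_succ, hstep]
    cases h <;> simp [motzkinSum, ih, hc]

/-- The `(p, q)`-analogue of `h`. -/
def pqNumber [Semiring R] (p q : R) (h : ℕ) : R := ∑ r ∈ range h, p ^ r * q ^ (h - 1 - r)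

theorem pqNumber_zero [Semiring R] (p q : R) : pqNumber p q 0 = 0 := by simp [pqNumber]

theorem sum_range_pow_mul_pow_reflect [Semiring R] (p q : R) (h : ℕ) :
    ∑ r ∈ range h, p ^ (h - 1 - r) * q ^ r = pqNumber p q h := by
  rw [pqNumber, ← sum_range_reflect]
  refine sum_congr rfl fun r hr => ?_
  rw [mem_range] at hr
  rw [show h - 1 - (h - 1 - r) = r by omega]

theorem sum_range_pow_mul_pow_succ [CommSemiring R] (p q : R) (h : ℕ) :
    ∑ r ∈ range h, p ^ r * q ^ (h - r) = q * pqNumber p q h := by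
  rw [pqNumber, mul_sum]
  refine sum_congr rfl fun r hr => ?_
  rw [mem_range] at hr
  rw [show h - r = h - 1 - r + 1 by omega]
  ring

end Motzkin

section Counting

variable {α β : Type*}

theorem card_filter_eq_add_of_iff_or {s : Finset α} {P Q T : α → Prop} [DecidablePred P]
    [DecidablePred Q] [DecidablePred T] (hT : ∀ i ∈ s, (T i ↔ P i ∨ Q i))
    (hdisj : ∀ i ∈ s, P i → ¬ Q i) :
    #{i ∈ s | T i} = #{i ∈ s | P i} + #{i ∈ s | Q i} := by
  classical
  rw [← card_union_of_disjoint (disjoint_filter.2 hdisj), ← filter_or, filter_congr hT]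

theorem card_filter_eq_add_ite {s : Finset α} {P Q : α → Prop} [DecidablePred P]
    [DecidablePred Q] {a : α} [Decidable (a ∈ s)] (h : ∀ i ∈ s, i ≠ a → (P i ↔ Q i))
    (ha : ¬ Q a) : #{i ∈ s | P i} = #{i ∈ s | Q i} + if a ∈ s ∧ P a then 1 else 0 := by
  classical
  rw [card_filter_eq_add_of_iff_or (P := Q) (Q := fun i => i = a ∧ P a)
    (fun i hi => by rcases eq_or_ne i a with rfl | hne <;> simp_all)
    (fun i _ hQ hia => ha (hia.1 ▸ hQ))]
  congr 1
  split_ifs with haP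
  · exact card_eq_one.2 ⟨a, by ext i; simp only [mem_filter, mem_singleton]; grind⟩
  · exact card_eq_zero.2 (filter_eq_empty_iff.2 fun i hi hia => haP ⟨hia.1 ▸ hi, hia.2⟩)

theorem card_filter_comp_equiv [Fintype α] [Fintype β] (e : α ≃ β) (P : β → Prop)
    [DecidablePred P] : #{a | P (e a)} = #{b | P b} :=
  card_equiv e (by simp)

theorem card_filter_product_left (s : Finset α) (t : Finset β) (P : α × β → Prop)
    [DecidablePred P] : #{x ∈ s ×ˢ t | P x} = ∑ a ∈ s, #{b ∈ t | P (a, b)} := by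
  simp only [card_filter, sum_product]

theorem card_filter_product_right (s : Finset α) (t : Finset β) (P : α × β → Prop)
    [DecidablePred P] : #{x ∈ s ×ˢ t | P x} = ∑ b ∈ t, #{a ∈ s | P (a, b)} := by
  simp only [card_filter, sum_product_right]

theorem strictMonoOn_card_filter_lt [Preorder α] [DecidableLT α] (s : Finset α) :
    StrictMonoOn (fun a => #{i ∈ s | i < a}) s := by
  intro a ha b _ hab
  refine card_lt_card ⟨monotone_filter_right s fun i _ hi => hi.trans hab, fun hsub => ?_⟩
  exact lt_irrefl a (mem_filter.1 (hsub (mem_filter.2 ⟨ha, hab⟩))).2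

theorem exists_pred_and_not_of_le {P : ℕ → Prop} {a b : ℕ} (hab : a ≤ b) (ha : P a)
    (hb : ¬ P b) : ∃ i, a < i ∧ i ≤ b ∧ P (i - 1) ∧ ¬ P i := by
  induction b, hab using Nat.le_induction with
  | base => exact absurd ha hb
  | succ b hab ih =>
    by_cases h : P b
    · exact ⟨b + 1, by omega, le_rfl, h, hb⟩
    · obtain ⟨i, hai, hib, hi⟩ := ih h
      exact ⟨i, hai, by omega, hi⟩

end Counting

section CyclicCoding

/-- The letters of the histories that code permutations by their cycle structure. The labels are the
numbers of arcs above the arc that ends (`r`) or starts (`s`) at the element from the left. -/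
inductive CyclicLetter
  | valley
  | fixed
  | doubleExcedance (r : ℕ)
  | doubleDrop (s : ℕ)
  | peak (r s : ℕ)

open Classical in
/-- The letters that may be read at height `h`. -/
noncomputable def cyclicLetters (h : ℕ) : Finset CyclicLetter :=
  {.valley, .fixed} ∪ (range h).image .doubleExcedance ∪ (range h).image .doubleDrop ∪
    (range h ×ˢ range h).image fun rs => CyclicLetter.peak rs.1 rs.2

/-- The histories that code permutations by their cycle structure; the state is the number of
upper arcs to be closed, which is also the number of lower arcs to be closed. -/
noncomputable def cyclicSystem : HistorySystem ℕ CyclicLetter where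
  letters := cyclicLetters
  next h
    | .valley => h + 1
    | .peak _ _ => h - 1
    | _ => h
  start := 0
  final := 0

/-- The weight of a letter read at height `h`. The factor `t`, which counts lower arcs, is attached
to the end of the arc at which it is opened. -/
def cyclicWeight {R : Type*} [Semiring R] (p q t u v w y : R) (h : ℕ) : CyclicLetter → R
  | .valley => t * w
  | .fixed => y * p ^ h
  | .doubleExcedance r => u * (p ^ r * q ^ (h - r))
  | .doubleDrop s => t * v * (p ^ s * q ^ (h - 1 - s))
  | .peak r s => p ^ r * q ^ (h - 1 - r) * (p ^ s * q ^ (h - 1 - s))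

theorem sum_cyclicLetters {M : Type*} [AddCommMonoid M] (h : ℕ) (f : CyclicLetter → M) :
    ∑ a ∈ cyclicLetters h, f a = f .valley + f .fixed + ∑ r ∈ range h, f (.doubleExcedance r) +
      ∑ s ∈ range h, f (.doubleDrop s) + ∑ r ∈ range h, ∑ s ∈ range h, f (.peak r s) := by
  classical
  rw [cyclicLetters, sum_union, sum_union, sum_union, sum_pair, sum_image, sum_image, sum_image,
    sum_product]
  · rintro ⟨r, s⟩ _ ⟨r', s'⟩ _ hrs
    rwa [CyclicLetter.peak.injEq, ← Prod.mk.injEq] at hrs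
  · exact fun _ _ _ _ hs => CyclicLetter.doubleDrop.inj hs
  · exact fun _ _ _ _ hr => CyclicLetter.doubleExcedance.inj hr
  all_goals grind [disjoint_left]

theorem totalWeight_cyclicSystem {R : Type*} [CommSemiring R] (p q t u v w y : R) (n : ℕ) :
    cyclicSystem.totalWeight (cyclicWeight p q t u v w y) n 0 =
      motzkinSum (fun _ => t * w) (fun h => y * p ^ h + (q * u + t * v) * pqNumber p q h)
        (fun h => pqNumber p q h ^ 2) n 0 := by
  refine HistorySystem.totalWeight_eq_motzkinSum rfl (by simp [pqNumber_zero]) (fun h f => ?_) n 0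
  simp only [cyclicSystem, sum_cyclicLetters, cyclicWeight, ← sum_mul, ← mul_sum,
    sum_range_pow_mul_pow_succ]
  rw [← pqNumber]
  ring

theorem totalWeight_cyclicSystem_one (n : ℕ) :
    cyclicSystem.totalWeight (fun _ _ => (1 : ℕ)) n 0 = n.factorial := by
  have cyclicWeight_one : cyclicWeight (1 : ℕ) 1 1 1 1 1 1 = fun _ _ => 1 := by
    funext h a
    cases a <;> simp [cyclicWeight]
  rw [← cyclicWeight_one, totalWeight_cyclicSystem,
    motzkinSum_zero_congr (a' := (· + 1)) (c' := fun h => h) _ (by simp [pqNumber, sq])]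
  simpa [pqNumber, add_comm] using motzkinSum_factorial n 0

variable {n : ℕ} {σ τ : Equiv.Perm (Fin n)} {x : Fin n}

/-- The number of arcs from `i` to `σ i` that cross the cut below `m` upwards. -/
def arcHeight (σ : Equiv.Perm (Fin n)) (m : ℕ) : ℕ := #{i : Fin n | (i : ℕ) < m ∧ m ≤ (σ i : ℕ)}

/-- The number of arcs from `i` to `σ i` that pass over `x` upwards. -/
def arcsOver (σ : Equiv.Perm (Fin n)) (x : Fin n) : ℕ := #{i | i < x ∧ x < σ i}

/-- The number of arcs `i < σ i` in which the arc from `σ.symm x` to `x` is nested, provided that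
`σ.symm x ≤ x`. -/
def arcsAbove (σ : Equiv.Perm (Fin n)) (x : Fin n) : ℕ := #{i | i < σ.symm x ∧ x < σ i}

/-- The number of crossings `i < j ≤ σ i < σ j` with `σ i = x`. -/
def upperCros (σ : Equiv.Perm (Fin n)) (x : Fin n) : ℕ := #{j | σ.symm x < j ∧ j ≤ x ∧ x < σ j}

/-- The number of crossings `i > j > σ i > σ j` with `j = x`, counted by the values `σ i`. -/
def lowerCros (σ : Equiv.Perm (Fin n)) (x : Fin n) : ℕ := #{y | σ x < y ∧ y < x ∧ x < σ.symm y}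

/-- The number of nestings that are counted at the right end `x` of their inner arc. -/
def nestAt (σ : Equiv.Perm (Fin n)) (x : Fin n) : ℕ :=
  (if σ.symm x ≤ x then arcsAbove σ x else 0) + if σ x < x then arcsAbove σ.symm x else 0

/-- The letter that codes the element `x`. -/
def cyclicLetter (σ : Equiv.Perm (Fin n)) (x : Fin n) : CyclicLetter :=
  if σ.symm x < x then
    if σ x < x then .peak (arcsAbove σ x) (arcsAbove σ.symm x)
    else .doubleExcedance (arcsAbove σ x)
  else if σ x < x then .doubleDrop (arcsAbove σ.symm x)
  else if σ x = x then .fixed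
  else .valley

theorem symm_apply_eq_self_iff (σ : Equiv.Perm (Fin n)) (x : Fin n) :
    σ.symm x = x ↔ σ x = x := by
  rw [Equiv.symm_apply_eq, eq_comm]

theorem cyclicLetter_cases (σ : Equiv.Perm (Fin n)) (x : Fin n) :
    (x < σ.symm x ∧ x < σ x ∧ cyclicLetter σ x = .valley) ∨
    (σ.symm x = x ∧ σ x = x ∧ cyclicLetter σ x = .fixed) ∨
    (σ.symm x < x ∧ x < σ x ∧ cyclicLetter σ x = .doubleExcedance (arcsAbove σ x)) ∨
    (x < σ.symm x ∧ σ x < x ∧ cyclicLetter σ x = .doubleDrop (arcsAbove σ.symm x)) ∨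
    (σ.symm x < x ∧ σ x < x ∧
      cyclicLetter σ x = .peak (arcsAbove σ x) (arcsAbove σ.symm x)) := by
  have := symm_apply_eq_self_iff σ x
  rcases lt_trichotomy (σ.symm x) x with h | h | h <;>
    rcases lt_trichotomy (σ x) x with h' | h' | h' <;> grind [cyclicLetter]

section Heights

theorem arcHeight_zero (σ : Equiv.Perm (Fin n)) : arcHeight σ 0 = 0 := by simp [arcHeight]

theorem arcHeight_last (σ : Equiv.Perm (Fin n)) : arcHeight σ n = 0 :=
  card_eq_zero.2 (filter_eq_empty_iff.2 fun i _ hi => (σ i).isLt.not_ge hi.2)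

theorem arcHeight_symm (σ : Equiv.Perm (Fin n)) (m : ℕ) : arcHeight σ.symm m = arcHeight σ m := by
  have hsource : arcHeight σ.symm m = #{i : Fin n | (σ i : ℕ) < m ∧ m ≤ (i : ℕ)} := by
    simpa [arcHeight] using
      (card_filter_comp_equiv σ fun i : Fin n => (i : ℕ) < m ∧ m ≤ (σ.symm i : ℕ)).symm
  have hbelow := card_filter_comp_equiv σ fun i : Fin n => (i : ℕ) < m
  rw [hsource, arcHeight]
  simpa only [← filter_and_not, not_lt] using card_sdiff_comm hbelow

theorem arcHeight_eq (σ : Equiv.Perm (Fin n)) (x : Fin n) :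
    arcHeight σ x = arcsOver σ x + if σ.symm x < x then 1 else 0 := by
  have hne (i : Fin n) (hi : i ≠ σ.symm x) : x ≠ σ i := fun h => hi (by simp [h])
  simpa [arcHeight, arcsOver] using card_filter_eq_add_ite
    (s := univ) (a := σ.symm x) (P := fun i : Fin n => (i : ℕ) < (x : ℕ) ∧ (x : ℕ) ≤ (σ i : ℕ))
    (Q := fun i => i < x ∧ x < σ i)
    (fun i _ hi => and_congr_right fun _ => (hne i hi).le_iff_lt) (by simp)

theorem arcHeight_eq_symm (σ : Equiv.Perm (Fin n)) (x : Fin n) :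
    arcHeight σ x = arcsOver σ.symm x + if σ x < x then 1 else 0 := by
  simpa only [arcHeight_symm, Equiv.symm_symm] using arcHeight_eq σ.symm x

theorem arcHeight_succ (σ : Equiv.Perm (Fin n)) (x : Fin n) :
    arcHeight σ (x + 1) = arcsOver σ x + if x < σ x then 1 else 0 := by
  simpa [arcHeight, arcsOver, Nat.succ_le_iff] using card_filter_eq_add_ite (s := univ) (a := x)
    (P := fun i : Fin n => (i : ℕ) < (x + 1 : ℕ) ∧ (x + 1 : ℕ) ≤ (σ i : ℕ))
    (Q := fun i => i < x ∧ x < σ i)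
    (fun i _ hi => and_congr_left fun _ => Nat.lt_succ_iff.trans hi.le_iff_lt) (by simp)

theorem arcsAbove_le (h : σ.symm x ≤ x) : arcsAbove σ x ≤ arcsOver σ x :=
  card_le_card (monotone_filter_right _ fun _ _ hi => ⟨hi.1.trans_le h, hi.2⟩)

theorem arcHeight_succ_eq_next (σ : Equiv.Perm (Fin n)) (x : Fin n) :
    arcHeight σ (x + 1) = cyclicSystem.next (arcHeight σ x) (cyclicLetter σ x) := by
  rw [arcHeight_succ, arcHeight_eq]
  rcases cyclicLetter_cases σ x with ⟨h, h', hl⟩ | ⟨h, h', hl⟩ | ⟨h, h', hl⟩ | ⟨h, h', hl⟩ |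
    ⟨h, h', hl⟩ <;>
    simp [cyclicSystem, hl, h, h', h.le.not_gt, h'.le.not_gt]

theorem cyclicLetter_mem (σ : Equiv.Perm (Fin n)) (x : Fin n) :
    cyclicLetter σ x ∈ cyclicSystem.letters (arcHeight σ x) := by
  classical
  have hupper := arcHeight_eq σ x
  have hlower := arcHeight_eq_symm σ x
  have hr := arcsAbove_le (σ := σ) (x := x)
  have hs := arcsAbove_le (σ := σ.symm) (x := x)
  rw [Equiv.symm_symm] at hs
  rcases cyclicLetter_cases σ x with ⟨_, _, hl⟩ | ⟨_, _, hl⟩ | ⟨_, _, hl⟩ | ⟨_, _, hl⟩ |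
    ⟨_, _, hl⟩ <;>
    simp only [cyclicSystem, cyclicLetters, hl, mem_union, mem_insert, mem_singleton, mem_image,
      mem_range, mem_product, Prod.exists] <;> grind

end Heights

section Injectivity

/-- The permutations `σ` and `τ` have the same arcs between elements below `m`. -/
def AgreeBelow (σ τ : Equiv.Perm (Fin n)) (m : ℕ) : Prop :=
  ∀ i y : Fin n, (i : ℕ) < m → (y : ℕ) < m → (σ i = y ↔ τ i = y)

theorem AgreeBelow.symm {m : ℕ} (h : AgreeBelow σ τ m) : AgreeBelow σ.symm τ.symm m := by
  intro i y hi hy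
  rw [Equiv.symm_apply_eq, Equiv.symm_apply_eq, eq_comm, h y i hy hi, eq_comm]

theorem arcsAbove_eq_card_filter (h : σ.symm x < x) :
    arcsAbove σ x = #{i ∈ univ.filter fun i => i < x ∧ x ≤ σ i | i < σ.symm x} := by
  rw [filter_filter]
  refine congrArg card (filter_congr fun i _ => ⟨fun hi => ⟨⟨hi.1.trans h, hi.2.le⟩, hi.1⟩,
    fun hi => ⟨hi.2, hi.1.2.lt_of_ne ?_⟩⟩)
  rintro rfl
  exact hi.2.ne (σ.symm_apply_apply i).symm

theorem AgreeBelow.symm_apply_eq (h : AgreeBelow σ τ x) (hσ : σ.symm x < x) (hτ : τ.symm x < x)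
    (habove : arcsAbove σ x = arcsAbove τ x) : σ.symm x = τ.symm x := by
  have hopen : univ.filter (fun i => i < x ∧ x ≤ σ i) = univ.filter fun i => i < x ∧ x ≤ τ i := by
    refine filter_congr fun i _ => and_congr_right fun hi => ?_
    rw [← not_lt, ← not_lt, not_iff_not]
    exact ⟨fun h' => by rwa [(h i _ hi h').1 rfl], fun h' => by rwa [(h i _ hi h').2 rfl]⟩
  rw [arcsAbove_eq_card_filter hσ, arcsAbove_eq_card_filter hτ, hopen] at habove
  refine (strictMonoOn_card_filter_lt _).injOn ?_ ?_ habove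
  · rw [← hopen]; simp [hσ]
  · simp [hτ]

theorem AgreeBelow.apply_eq_iff (h : AgreeBelow σ τ x) (hlt : σ.symm x < x ↔ τ.symm x < x)
    (habove : σ.symm x < x → arcsAbove σ x = arcsAbove τ x) {i : Fin n} (hi : i < x) :
    σ i = x ↔ τ i = x := by
  rw [← Equiv.eq_symm_apply, ← Equiv.eq_symm_apply]
  by_cases hσ : σ.symm x < x
  · rw [h.symm_apply_eq hσ (hlt.1 hσ) (habove hσ)]
  · exact iff_of_false (fun hi' => hσ (hi' ▸ hi)) (fun hi' => hσ (hlt.2 (hi' ▸ hi)))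

theorem AgreeBelow.succ (h : AgreeBelow σ τ x) (hletter : cyclicLetter σ x = cyclicLetter τ x) :
    AgreeBelow σ τ (x + 1) := by
  obtain ⟨hin, hout, hfix, hr, hs⟩ : (σ.symm x < x ↔ τ.symm x < x) ∧ (σ x < x ↔ τ x < x) ∧
      (σ x = x ↔ τ x = x) ∧ (σ.symm x < x → arcsAbove σ x = arcsAbove τ x) ∧
      (σ x < x → arcsAbove σ.symm x = arcsAbove τ.symm x) := by
    have := cyclicLetter_cases σ x
    have := cyclicLetter_cases τ x
    grind
  intro i y hi hy
  rcases (Fin.le_def.2 (Nat.lt_succ_iff.1 hi)).lt_or_eq with hix | rfl <;>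
    rcases (Fin.le_def.2 (Nat.lt_succ_iff.1 hy)).lt_or_eq with hyx | rfl
  · exact h i y hix hyx
  · exact h.apply_eq_iff hin hr hix
  · rw [eq_comm, ← Equiv.symm_apply_eq, eq_comm (a := τ i), ← Equiv.symm_apply_eq]
    exact h.symm.apply_eq_iff hout hs hyx
  · exact hfix

theorem cyclicLetter_injective : Function.Injective (cyclicLetter (n := n)) := by
  intro σ τ hletter
  have hagree (m : ℕ) (hm : m ≤ n) : AgreeBelow σ τ m := by
    induction m with
    | zero => exact fun i y hi => absurd hi (Nat.not_lt_zero _)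
    | succ m ih => exact (ih (by omega)).succ (x := ⟨m, hm⟩) (congrFun hletter _)
  ext1 i
  exact ((hagree n le_rfl i (σ i) i.isLt (σ i).isLt).1 rfl).symm

end Injectivity

/-- The coding of permutations by their cycle structure (Foata–Zeilberger). -/
def cyclicCoding (n : ℕ) : cyclicSystem.Coding (Equiv.Perm (Fin n)) n where
  letter := cyclicLetter
  state := arcHeight
  state_zero := arcHeight_zero
  state_last := arcHeight_last
  letter_mem := cyclicLetter_mem
  state_succ := arcHeight_succ_eq_next
  letter_injective := cyclicLetter_injective

section Weights

theorem nest_eq_sum (σ : Equiv.Perm (Fin n)) : nest σ = ∑ x, nestAt σ x := by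
  simp only [nest, nestAt, sum_add_distrib]
  rw [card_filter_eq_add_of_iff_or (fun _ _ => Iff.rfl) fun _ _ h h' => lt_asymm h.1 h'.1,
    ← univ_product_univ, card_filter_product_right, card_filter_product_right]
  congr 1
  · rw [← Equiv.sum_comp σ.symm]
    refine sum_congr rfl fun x _ => ?_
    split_ifs with h <;> simp [arcsAbove, h]
  · refine sum_congr rfl fun x _ => ?_
    rw [← card_filter_comp_equiv σ.symm]
    split_ifs with h <;> simp [arcsAbove, h, and_comm]

theorem cros_eq_sum (σ : Equiv.Perm (Fin n)) :
    cros σ = ∑ x, (upperCros σ x + lowerCros σ x) := by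
  rw [cros, card_filter_eq_add_of_iff_or (fun _ _ => Iff.rfl) fun _ _ h h' => lt_asymm h.1 h'.1,
    sum_add_distrib, ← univ_product_univ, card_filter_product_left, card_filter_product_right]
  congr 1
  · rw [← Equiv.sum_comp σ.symm]
    simp only [upperCros, Equiv.apply_symm_apply]
  · refine sum_congr rfl fun x _ => ?_
    rw [← card_filter_comp_equiv σ.symm, lowerCros]
    refine congrArg card (filter_congr fun y _ => ?_)
    simp only [Equiv.apply_symm_apply]
    tauto

theorem card_lt_apply_eq (σ : Equiv.Perm (Fin n)) : #{x | x < σ x} = cvalley σ + cda σ :=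
  card_filter_eq_add_of_iff_or (fun x _ => by have := symm_apply_eq_self_iff σ x; grind)
    fun _ _ h h' => lt_asymm h.1 h'.1

theorem card_lt_symm_apply_eq (σ : Equiv.Perm (Fin n)) :
    #{x | x < σ.symm x} = cvalley σ + cdd σ :=
  card_filter_eq_add_of_iff_or (fun x _ => by have := symm_apply_eq_self_iff σ x; grind)
    fun _ _ h h' => lt_asymm h.2 h'.2

theorem drop_eq_card_lt_symm_apply (σ : Equiv.Perm (Fin n)) : drop σ = #{x | x < σ.symm x} := by
  simpa [drop] using card_filter_comp_equiv σ fun x => x < σ.symm x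

theorem fix_add_two_mul_cvalley_add_cda_add_cdd (σ : Equiv.Perm (Fin n)) :
    fix σ + 2 * cvalley σ + cda σ + cdd σ = n := by
  have htotal : #{x | σ x = x} + (#{x | x < σ x} + #{x | σ x < x}) = n := by
    rw [← card_filter_eq_add_of_iff_or (T := fun x => σ x ≠ x) (by grind) (by grind),
      card_filter_add_card_filter_not, card_univ, Fintype.card_fin]
  have hexc := card_lt_apply_eq σ
  have hdrop : #{x | σ x < x} = _ :=
    (drop_eq_card_lt_symm_apply σ).trans (card_lt_symm_apply_eq σ)
  rw [fix]
  omega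

theorem arcsAbove_add_upperCros (h : σ.symm x < x) :
    arcsAbove σ x + upperCros σ x = arcHeight σ (x + 1) := by
  refine (card_filter_eq_add_of_iff_or (fun i _ => ?_) fun i _ hi hi' => lt_asymm hi.1 hi'.1).symm
  have : x < σ i → i ≠ σ.symm x := fun h h' => by simp [h'] at h
  grind

theorem arcsAbove_symm_add_lowerCros (h : σ x < x) :
    arcsAbove σ.symm x + lowerCros σ x = arcsOver σ.symm x := by
  refine (card_filter_eq_add_of_iff_or (fun i _ => ?_) fun i _ hi hi' => lt_asymm hi.1 hi'.1).symm
  have : x < σ.symm i → i ≠ σ x := fun h h' => by simp [h'] at h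
  grind

theorem upperCros_eq_zero (h : x ≤ σ.symm x) : upperCros σ x = 0 :=
  card_eq_zero.2 (filter_eq_empty_iff.2 fun _ _ hi => (h.trans_lt hi.1).not_ge hi.2.1)

theorem lowerCros_eq_zero (h : x ≤ σ x) : lowerCros σ x = 0 :=
  card_eq_zero.2 (filter_eq_empty_iff.2 fun _ _ hi => (h.trans_lt hi.1).not_gt hi.2.1)

theorem upperCros_eq (h : σ.symm x < x) :
    upperCros σ x = arcHeight σ (x + 1) - arcsAbove σ x := by
  rw [← arcsAbove_add_upperCros h, Nat.add_sub_cancel_left]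

theorem lowerCros_eq (h : σ x < x) :
    lowerCros σ x = arcHeight σ x - 1 - arcsAbove σ.symm x := by
  rw [arcHeight_eq_symm, if_pos h, Nat.add_sub_cancel, ← arcsAbove_symm_add_lowerCros h,
    Nat.add_sub_cancel_left]

theorem arcsAbove_eq_arcHeight (h : σ x = x) : arcsAbove σ x = arcHeight σ x := by
  have h' := (symm_apply_eq_self_iff σ x).2 h
  simp [arcHeight_eq, arcsAbove, arcsOver, h']

theorem cyclicWeight_cyclicLetter {R : Type*} [CommSemiring R] (p q t u v w y : R)
    (σ : Equiv.Perm (Fin n)) (x : Fin n) :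
    cyclicWeight p q t u v w y (arcHeight σ x) (cyclicLetter σ x) =
      p ^ nestAt σ x * q ^ (upperCros σ x + lowerCros σ x) *
        t ^ (if x < σ.symm x then 1 else 0) * u ^ (if σ.symm x < x ∧ x < σ x then 1 else 0) *
        v ^ (if σ.symm x > x ∧ x > σ x then 1 else 0) *
        w ^ (if σ.symm x > x ∧ x < σ x then 1 else 0) * y ^ (if σ x = x then 1 else 0) := by
  have hnext := arcHeight_succ_eq_next σ x
  rcases cyclicLetter_cases σ x with ⟨h, h', hl⟩ | ⟨h, h', hl⟩ | ⟨h, h', hl⟩ | ⟨h, h', hl⟩ |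
    ⟨h, h', hl⟩ <;> rw [hl] at hnext ⊢
  · simp [cyclicWeight, nestAt, upperCros_eq_zero h.le, lowerCros_eq_zero h'.le, h, h', h.not_gt,
      h.not_ge, h'.not_gt, h'.ne']
  · simp [cyclicWeight, nestAt, upperCros_eq_zero h.ge, lowerCros_eq_zero h'.ge,
      arcsAbove_eq_arcHeight h', h, h', mul_comm]
  · simp [cyclicWeight, nestAt, upperCros_eq h, lowerCros_eq_zero h'.le, hnext, cyclicSystem, h,
      h', h.le, h.not_gt, h'.not_gt, h'.ne', mul_comm]
  · simp only [cyclicWeight, nestAt, upperCros_eq_zero h.le, lowerCros_eq h', h, h', h.not_ge,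
      h.not_gt, h'.not_gt, h'.ne, if_true, if_false, and_self, and_false, zero_add]
    ring
  · simp only [cyclicWeight, nestAt, upperCros_eq h, lowerCros_eq h', hnext, cyclicSystem, h, h',
      h.le, h.not_gt, h'.not_gt, h'.ne, if_true, if_false, and_true, and_false]
    ring

theorem B_eq_motzkinSum {R : Type*} [CommRing R] (n : ℕ) (p q t u v w y : R) :
    B n p q t u v w y =
      motzkinSum (fun _ => t * w) (fun h => y * p ^ h + (q * u + t * v) * pqNumber p q h)
        (fun h => pqNumber p q h ^ 2) n 0 := by
  rw [← totalWeight_cyclicSystem]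
  refine Eq.trans ?_ ((cyclicCoding n).sum_prod_eq_totalWeight _ ?_)
  · refine sum_congr rfl fun σ _ => ?_
    rw [nest_eq_sum, cros_eq_sum, drop_eq_card_lt_symm_apply, cda, cdd, cvalley, fix]
    simp only [card_filter, ← prod_pow_eq_pow_sum, ← prod_mul_distrib]
    exact prod_congr rfl fun x _ => (cyclicWeight_cyclicLetter p q t u v w y σ x).symm
  · exact (totalWeight_cyclicSystem_one n).trans_le (by simp [Fintype.card_perm])

end Weights

end CyclicCoding

section Words

variable {n : ℕ}

/-- The one-based position of the letter `x` in the word of `σ`. -/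
def pos (σ : Equiv.Perm (Fin n)) (x : Fin n) : ℕ := (σ.symm x : ℕ) + 1

theorem one_le_pos (σ : Equiv.Perm (Fin n)) (x : Fin n) : 1 ≤ pos σ x := Nat.le_add_left _ _

theorem pos_le (σ : Equiv.Perm (Fin n)) (x : Fin n) : pos σ x ≤ n := (σ.symm x).isLt

theorem pos_injective (σ : Equiv.Perm (Fin n)) : Function.Injective (pos σ) := fun _ _ h =>
  σ.symm.injective (Fin.ext (Nat.succ_injective h))

theorem exists_pos_eq (σ : Equiv.Perm (Fin n)) {i : ℕ} (hi : i ∈ Icc 1 n) : ∃ x, pos σ x = i := by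
  rw [mem_Icc] at hi
  refine ⟨σ ⟨i - 1, by omega⟩, ?_⟩
  rw [pos, Equiv.symm_apply_apply]
  exact Nat.sub_add_cancel hi.1

theorem pos_mem_Icc (σ : Equiv.Perm (Fin n)) (x : Fin n) : pos σ x ∈ Icc 1 n :=
  mem_Icc.2 ⟨one_le_pos σ x, pos_le σ x⟩

theorem word_pos (σ : Equiv.Perm (Fin n)) (x : Fin n) : word σ (pos σ x) = x + 1 := by
  rw [word, dif_pos ⟨one_le_pos σ x, pos_le σ x⟩]
  simp [pos]

theorem word_zero (σ : Equiv.Perm (Fin n)) : word σ 0 = 0 := by simp [word]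

theorem word_add_one (σ : Equiv.Perm (Fin n)) : word σ (n + 1) = n + 1 := by simp [word]

theorem one_le_word (σ : Equiv.Perm (Fin n)) {i : ℕ} (h : 1 ≤ i) : 1 ≤ word σ i := by
  unfold word
  split_ifs <;> omega

theorem word_le (σ : Equiv.Perm (Fin n)) {i : ℕ} (h : i ≤ n) : word σ i ≤ n := by
  unfold word
  split_ifs
  · exact (σ _).isLt
  · exact h

theorem word_eq_iff (σ : Equiv.Perm (Fin n)) (i : ℕ) (x : Fin n) :
    word σ i = x + 1 ↔ i = pos σ x := by
  refine ⟨fun h => ?_, fun h => by rw [h, word_pos]⟩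
  by_cases hi : 1 ≤ i ∧ i ≤ n
  · obtain ⟨z, rfl⟩ := exists_pos_eq σ (mem_Icc.2 hi)
    rw [word_pos, Nat.add_right_cancel_iff] at h
    rw [Fin.ext h]
  · have := x.isLt
    rw [word, dif_neg hi] at h
    omega

theorem word_pos_sub_one_ne (σ : Equiv.Perm (Fin n)) (x : Fin n) :
    word σ (pos σ x - 1) ≠ x + 1 := by
  have := one_le_pos σ x
  rw [ne_eq, word_eq_iff]
  omega

theorem word_pos_add_one_ne (σ : Equiv.Perm (Fin n)) (x : Fin n) :
    word σ (pos σ x + 1) ≠ x + 1 := by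
  rw [ne_eq, word_eq_iff]
  omega

theorem sum_Icc_eq_sum_pos {M : Type*} [AddCommMonoid M] (σ : Equiv.Perm (Fin n)) (f : ℕ → M) :
    ∑ i ∈ Icc 1 n, f i = ∑ x : Fin n, f (pos σ x) :=
  (sum_nbij (pos σ) (fun x _ => pos_mem_Icc σ x) (pos_injective σ).injOn
    (fun i hi => by simpa using exists_pos_eq σ hi) fun _ _ => rfl).symm

theorem eq_of_pos_lt_pos_iff {σ τ : Equiv.Perm (Fin n)}
    (h : ∀ x z, pos σ x < pos σ z ↔ pos τ x < pos τ z) : σ = τ := by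
  have card_pos_lt (ρ : Equiv.Perm (Fin n)) (z : Fin n) : #{x | pos ρ x < pos ρ z} = ρ.symm z := by
    simpa [pos, filter_gt_eq_Iio] using card_filter_comp_equiv ρ.symm fun i => i < ρ.symm z
  refine Equiv.symm_bijective.injective (Equiv.ext fun z => Fin.ext ?_)
  simp only [← card_pos_lt, h]

end Words

section Descents

variable {n : ℕ} {σ τ : Equiv.Perm (Fin n)} {x : Fin n}

/-- The number of descents within the first `N` positions from a letter above `X` to a letter below
`X`. -/
def descentsOver (σ : Equiv.Perm (Fin n)) (N X : ℕ) : ℕ :=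
  #{i ∈ Icc 1 N | X < word σ (i - 1) ∧ word σ i < X}

/-- The number of descents within the first `N` positions from a letter above `m` to a letter that
is at most `m`. -/
def cutDescents (σ : Equiv.Perm (Fin n)) (N m : ℕ) : ℕ :=
  #{i ∈ Icc 1 N | m < word σ (i - 1) ∧ word σ i ≤ m}

/-- The number of patterns 31-2 in which `x` plays the role of the `2`. -/
def lesAt (σ : Equiv.Perm (Fin n)) (x : Fin n) : ℕ := descentsOver σ (pos σ x) (x + 1)

/-- The number of patterns 2-31 in which `x` plays the role of the `2`. -/
def ressAt (σ : Equiv.Perm (Fin n)) (x : Fin n) : ℕ :=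
  #{i ∈ Icc 1 n | pos σ x < i ∧ (x : ℕ) + 1 < word σ (i - 1) ∧ word σ i < x + 1}

theorem cutDescents_eq (σ : Equiv.Perm (Fin n)) (N : ℕ) (x : Fin n) :
    cutDescents σ N x = descentsOver σ N (x + 1) +
      if pos σ x < N ∧ word σ (pos σ x + 1) < x + 1 then 1 else 0 := by
  rw [cutDescents, descentsOver, card_filter_eq_add_ite (a := pos σ x + 1)
    (P := fun i => (x : ℕ) < word σ (i - 1) ∧ word σ i ≤ x)
    (Q := fun i => (x : ℕ) + 1 < word σ (i - 1) ∧ word σ i < x + 1)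
    (fun i hi hne => ?_) (by simp [word_pos])]
  · simp [word_pos]
  · have := word_eq_iff σ (i - 1) x
    rw [mem_Icc] at hi
    omega

theorem cutDescents_succ (σ : Equiv.Perm (Fin n)) (N : ℕ) (x : Fin n) :
    cutDescents σ N (x + 1) = descentsOver σ N (x + 1) +
      if pos σ x ≤ N ∧ x + 1 < word σ (pos σ x - 1) then 1 else 0 := by
  rw [cutDescents, descentsOver, card_filter_eq_add_ite (a := pos σ x)
    (P := fun i => (x : ℕ) + 1 < word σ (i - 1) ∧ word σ i ≤ x + 1)
    (Q := fun i => (x : ℕ) + 1 < word σ (i - 1) ∧ word σ i < x + 1)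
    (fun i _ hne => ?_) (by simp [word_pos])]
  · simp [word_pos, one_le_pos]
  · have := word_eq_iff σ i x
    omega

theorem cutDescents_zero (σ : Equiv.Perm (Fin n)) : cutDescents σ n 0 = 0 :=
  card_eq_zero.2 (filter_eq_empty_iff.2 fun _ hi h =>
    (one_le_word σ (mem_Icc.1 hi).1).not_gt (Nat.lt_succ_iff.2 h.2))

theorem cutDescents_last (σ : Equiv.Perm (Fin n)) : cutDescents σ n n = 0 :=
  card_eq_zero.2 (filter_eq_empty_iff.2 fun _ hi h =>
    h.1.not_ge (word_le σ ((Nat.sub_le _ _).trans (mem_Icc.1 hi).2)))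

theorem cutDescents_mono (σ : Equiv.Perm (Fin n)) {N N' : ℕ} (h : N ≤ N') (m : ℕ) :
    cutDescents σ N m ≤ cutDescents σ N' m :=
  card_le_card (filter_subset_filter _ (Icc_subset_Icc_right h))

theorem cutDescents_lt {N N' m : ℕ} (h : N ≤ N') (hN : m < word σ N) (hN' : word σ N' ≤ m) :
    cutDescents σ N m < cutDescents σ N' m := by
  obtain ⟨i, hNi, hiN', hpred, hi⟩ :=
    exists_pred_and_not_of_le (P := fun i => m < word σ i) h hN hN'.not_gt
  refine card_lt_card ⟨filter_subset_filter _ (Icc_subset_Icc_right h), fun hsub => ?_⟩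
  have := hsub (mem_filter.2 ⟨mem_Icc.2 ⟨by omega, hiN'⟩, hpred, not_lt.1 hi⟩)
  rw [mem_filter, mem_Icc] at this
  omega

theorem cutDescents_pos_self (σ : Equiv.Perm (Fin n)) (x : Fin n) :
    cutDescents σ (pos σ x) x = lesAt σ x := by
  rw [cutDescents_eq, if_neg fun h => lt_irrefl _ h.1, lesAt, add_zero]

theorem pos_lt_pos_iff {z : Fin n} (h : z < x) :
    pos σ z < pos σ x ↔ cutDescents σ (pos σ z) x ≤ lesAt σ x := by
  rw [← cutDescents_pos_self]
  refine ⟨fun hlt => cutDescents_mono σ hlt.le _, fun hle => ?_⟩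
  contrapose! hle
  exact cutDescents_lt hle (by rw [word_pos]; exact Nat.lt_succ_self _) (by rwa [word_pos])

theorem lesAt_add_ressAt (σ : Equiv.Perm (Fin n)) (x : Fin n) :
    lesAt σ x + ressAt σ x = descentsOver σ n (x + 1) := by
  have hles : lesAt σ x =
      #{i ∈ Icc 1 n | i ≤ pos σ x ∧ (x : ℕ) + 1 < word σ (i - 1) ∧ word σ i < x + 1} := by
    rw [lesAt, descentsOver]
    congr 1
    ext i
    have := pos_le σ x
    simp only [mem_filter, mem_Icc]
    omega
  rw [hles]
  exact (card_filter_eq_add_of_iff_or (by omega) (by omega)).symm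

theorem cutDescents_last_eq (σ : Equiv.Perm (Fin n)) (x : Fin n) :
    cutDescents σ n x = lesAt σ x + ressAt σ x +
      if word σ (pos σ x + 1) < x + 1 then 1 else 0 := by
  rw [cutDescents_eq, lesAt_add_ressAt]
  refine congrArg _ (if_congr (and_iff_right_of_imp fun h => (pos_le σ x).lt_of_ne fun hn => ?_)
    rfl rfl)
  rw [hn, word_add_one] at h
  omega

theorem cutDescents_last_succ (σ : Equiv.Perm (Fin n)) (x : Fin n) :
    cutDescents σ n (x + 1) = lesAt σ x + ressAt σ x +
      if x + 1 < word σ (pos σ x - 1) then 1 else 0 := by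
  simp only [cutDescents_succ, lesAt_add_ressAt, pos_le, true_and]

theorem les_eq_sum (σ : Equiv.Perm (Fin n)) : les σ = ∑ x, lesAt σ x := by
  rw [les, card_filter_product_right, sum_subset (s₂ := Icc 1 n)
    (Icc_subset_Icc_left one_le_two), sum_Icc_eq_sum_pos σ]
  · refine sum_congr rfl fun x _ => ?_
    rw [lesAt, descentsOver]
    congr 1
    ext i
    have := pos_le σ x
    have := word_eq_iff σ i x
    have : i = 1 → word σ (i - 1) = 0 := by rintro rfl; exact word_zero σ
    simp only [mem_filter, mem_Icc, word_pos]
    omega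
  · intro j hj hj'
    refine card_eq_zero.2 (filter_eq_empty_iff.2 fun i hi => ?_)
    simp only [mem_Icc] at hi hj hj'
    omega

theorem ress_eq_sum (σ : Equiv.Perm (Fin n)) : ress σ = ∑ x, ressAt σ x := by
  rw [ress, card_filter_product_left, sum_subset (s₂ := Icc 1 n)
    (Icc_subset_Icc_right (Nat.sub_le n 1)), sum_Icc_eq_sum_pos σ]
  · refine sum_congr rfl fun x _ => ?_
    have := one_le_pos σ x
    refine card_nbij' (· + 1) (· - 1) (fun i hi => ?_) (fun i hi => ?_) (fun i _ => rfl)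
      fun i hi => ?_ <;> simp only [mem_coe, mem_filter, mem_Icc, word_pos] at hi ⊢
    · simp only [Nat.add_sub_cancel]
      omega
    · have := word_eq_iff σ (i - 1) x
      rw [Nat.sub_add_cancel hi.1.1]
      omega
    · omega
  · intro j hj hj'
    refine card_eq_zero.2 (filter_eq_empty_iff.2 fun i hi => ?_)
    simp only [mem_Icc] at hi hj hj'
    omega

end Descents

section LinearCoding

/-- The letters of the histories that code permutations by their words. The labels are the numbers
of patterns 31-2 in which the letter plays the role of the `2`. -/
inductive WordLetter
  | valley (r : ℕ)
  | doubleAscent (r : ℕ)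
  | doubleDescent (r : ℕ)
  | peak (r : ℕ)

open Classical in
/-- The letters that may be read at height `h`. -/
noncomputable def wordLetters (h : ℕ) : Finset WordLetter :=
  (range (h + 1)).image .valley ∪ (range (h + 1)).image .doubleAscent ∪
    (range h).image .doubleDescent ∪ (range h).image .peak

/-- The histories that code permutations by their words; the state is the number of descents from
above to below the cut between two consecutive values. -/
noncomputable def wordSystem : HistorySystem ℕ WordLetter where
  letters := wordLetters
  next h
    | .valley _ => h + 1
    | .peak _ => h - 1
    | _ => h
  start := 0
  final := 0

/-- The weight of a letter read at height `h`, which vanishes for the double ascents that are not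
foremaxima. -/
def linearWeight {R : Type*} [Semiring R] (p q w y : R) (h : ℕ) : WordLetter → R
  | .valley r => w * (p ^ (h - r) * q ^ r)
  | .doubleAscent r => if r = 0 then y * p ^ h else 0
  | .doubleDescent r | .peak r => p ^ (h - 1 - r) * q ^ r

theorem sum_wordLetters {M : Type*} [AddCommMonoid M] (h : ℕ) (f : WordLetter → M) :
    ∑ a ∈ wordLetters h, f a = ∑ r ∈ range (h + 1), f (.valley r) +
      ∑ r ∈ range (h + 1), f (.doubleAscent r) + ∑ r ∈ range h, f (.doubleDescent r) +
      ∑ r ∈ range h, f (.peak r) := by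
  classical
  rw [wordLetters, sum_union, sum_union, sum_union, sum_image, sum_image, sum_image, sum_image]
  · exact fun _ _ _ _ hr => WordLetter.peak.inj hr
  · exact fun _ _ _ _ hr => WordLetter.doubleDescent.inj hr
  · exact fun _ _ _ _ hr => WordLetter.doubleAscent.inj hr
  · exact fun _ _ _ _ hr => WordLetter.valley.inj hr
  all_goals grind [disjoint_left]

theorem totalWeight_wordSystem {R : Type*} [CommSemiring R] (p q w y : R) (n : ℕ) :
    wordSystem.totalWeight (linearWeight p q w y) n 0 =
      motzkinSum (fun h => w * pqNumber p q (h + 1)) (fun h => y * p ^ h + pqNumber p q h)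
        (pqNumber p q) n 0 := by
  refine HistorySystem.totalWeight_eq_motzkinSum rfl (pqNumber_zero p q) (fun h f => ?_) n 0
  have hvalley := sum_range_pow_mul_pow_reflect p q (h + 1)
  rw [Nat.add_sub_cancel] at hvalley
  simp only [wordSystem, sum_wordLetters, linearWeight, ← sum_mul, ← mul_sum, hvalley,
    sum_range_pow_mul_pow_reflect, sum_ite_eq', mem_range, Nat.succ_pos, if_true]
  ring

theorem totalWeight_wordSystem_one (n : ℕ) :
    wordSystem.totalWeight (fun _ _ => (1 : ℕ)) n 0 = n.factorial := by
  rw [HistorySystem.totalWeight_eq_motzkinSum (a := (· + 1)) (b := (2 * · + 1)) (c := fun h => h)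
    rfl rfl (fun h f => ?_), motzkinSum_factorial, Nat.choose_zero_right, mul_one]
  simp only [wordSystem, sum_wordLetters, one_mul, sum_const, card_range, smul_eq_mul]
  ring

variable {n : ℕ} {σ τ : Equiv.Perm (Fin n)} {x : Fin n}

/-- The letter that codes the value `x` of the word. -/
def wordLetter (σ : Equiv.Perm (Fin n)) (x : Fin n) : WordLetter :=
  if x + 1 < word σ (pos σ x - 1) then
    if x + 1 < word σ (pos σ x + 1) then .valley (lesAt σ x) else .doubleDescent (lesAt σ x)
  else if x + 1 < word σ (pos σ x + 1) then .doubleAscent (lesAt σ x)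
  else .peak (lesAt σ x)

theorem wordLetter_cases (σ : Equiv.Perm (Fin n)) (x : Fin n) :
    (x + 1 < word σ (pos σ x - 1) ∧ x + 1 < word σ (pos σ x + 1) ∧
      wordLetter σ x = .valley (lesAt σ x)) ∨
    (word σ (pos σ x - 1) < x + 1 ∧ x + 1 < word σ (pos σ x + 1) ∧
      wordLetter σ x = .doubleAscent (lesAt σ x)) ∨
    (x + 1 < word σ (pos σ x - 1) ∧ word σ (pos σ x + 1) < x + 1 ∧
      wordLetter σ x = .doubleDescent (lesAt σ x)) ∨
    (word σ (pos σ x - 1) < x + 1 ∧ word σ (pos σ x + 1) < x + 1 ∧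
      wordLetter σ x = .peak (lesAt σ x)) := by
  rcases (word_pos_sub_one_ne σ x).lt_or_gt with h | h <;>
    rcases (word_pos_add_one_ne σ x).lt_or_gt with h' | h' <;>
    simp [wordLetter, h, h', h.not_gt, h'.not_gt]

theorem wordLetter_mem (σ : Equiv.Perm (Fin n)) (x : Fin n) :
    wordLetter σ x ∈ wordSystem.letters (cutDescents σ n x) := by
  classical
  have hcut := cutDescents_last_eq σ x
  rcases wordLetter_cases σ x with ⟨_, h', hl⟩ | ⟨_, h', hl⟩ | ⟨_, h', hl⟩ | ⟨_, h', hl⟩ <;>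
    simp only [wordSystem, wordLetters, hl, mem_union, mem_image, mem_range] <;> grind

theorem cutDescents_last_succ_eq_next (σ : Equiv.Perm (Fin n)) (x : Fin n) :
    cutDescents σ n (x + 1) = wordSystem.next (cutDescents σ n x) (wordLetter σ x) := by
  rw [cutDescents_last_succ, cutDescents_last_eq]
  rcases wordLetter_cases σ x with ⟨h, h', hl⟩ | ⟨h, h', hl⟩ | ⟨h, h', hl⟩ | ⟨h, h', hl⟩ <;>
    simp [wordSystem, hl, h, h', h.not_gt, h'.not_gt]

section Injectivity

/-- The letters below `m` occur in the same order in the words of `σ` and `τ`, and each of them is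
preceded by the same number of descents from above to below `m`. -/
structure WordsAgreeBelow (σ τ : Equiv.Perm (Fin n)) (m : ℕ) : Prop where
  pos_lt_iff : ∀ x z : Fin n, (x : ℕ) < m → (z : ℕ) < m →
    (pos σ x < pos σ z ↔ pos τ x < pos τ z)
  cut_eq : ∀ x : Fin n, (x : ℕ) < m → cutDescents σ (pos σ x) m = cutDescents τ (pos τ x) m

theorem WordsAgreeBelow.succ (h : WordsAgreeBelow σ τ x)
    (hletter : wordLetter σ x = wordLetter τ x) : WordsAgreeBelow σ τ (x + 1) := by
  obtain ⟨hles, hpred, hsucc⟩ : lesAt σ x = lesAt τ x ∧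
      (x + 1 < word σ (pos σ x - 1) ↔ x + 1 < word τ (pos τ x - 1)) ∧
      (word σ (pos σ x + 1) < x + 1 ↔ word τ (pos τ x + 1) < x + 1) := by
    have := wordLetter_cases σ x
    have := wordLetter_cases τ x
    grind
  have hlt {z : Fin n} (hz : z < x) : pos σ z < pos σ x ↔ pos τ z < pos τ x := by
    rw [pos_lt_pos_iff hz, pos_lt_pos_iff hz, h.cut_eq z hz, hles]
  have hgt {z : Fin n} (hz : z < x) : pos σ x < pos σ z ↔ pos τ x < pos τ z := by
    rw [← not_iff_not, not_lt, not_lt, ((pos_injective σ).ne hz.ne).le_iff_lt,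
      ((pos_injective τ).ne hz.ne).le_iff_lt, hlt hz]
  refine ⟨fun z z' hz hz' => ?_, fun z hz => ?_⟩
  · rcases (Fin.le_def.2 (Nat.lt_succ_iff.1 hz)).lt_or_eq with hzx | rfl <;>
      rcases (Fin.le_def.2 (Nat.lt_succ_iff.1 hz')).lt_or_eq with hzx' | rfl
    · exact h.pos_lt_iff z z' hzx hzx'
    · exact hlt hzx
    · exact hgt hzx'
    · simp
  · rw [cutDescents_succ, cutDescents_succ]
    rcases (Fin.le_def.2 (Nat.lt_succ_iff.1 hz)).lt_or_eq with hzx | rfl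
    · have hcut := h.cut_eq z hzx
      simp only [cutDescents_eq, hgt hzx, hsucc, Nat.add_right_cancel_iff] at hcut
      simp only [← not_lt, hlt hzx, hpred, hcut]
    · simp only [le_rfl, hpred, true_and]
      exact congrArg (· + _) hles

theorem wordLetter_injective : Function.Injective (wordLetter (n := n)) := by
  intro σ τ hletter
  have hagree (m : ℕ) (hm : m ≤ n) : WordsAgreeBelow σ τ m := by
    induction m with
    | zero => exact ⟨fun x _ hx => absurd hx (Nat.not_lt_zero _),
        fun x hx => absurd hx (Nat.not_lt_zero _)⟩
    | succ m ih => exact (ih (by omega)).succ (x := ⟨m, hm⟩) (congrFun hletter _)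
  exact eq_of_pos_lt_pos_iff fun x z => (hagree n le_rfl).pos_lt_iff x z x.isLt z.isLt

end Injectivity

/-- The coding of permutations by their words (Françon–Viennot). -/
noncomputable def wordCoding (n : ℕ) : wordSystem.Coding (Equiv.Perm (Fin n)) n where
  letter := wordLetter
  state σ := cutDescents σ n
  state_zero := cutDescents_zero
  state_last := cutDescents_last
  letter_mem := wordLetter_mem
  state_succ := cutDescents_last_succ_eq_next
  letter_injective := wordLetter_injective

section Weights

theorem isDoubleAscent_pos (σ : Equiv.Perm (Fin n)) (x : Fin n) :
    IsDoubleAscent σ (pos σ x) ↔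
      word σ (pos σ x - 1) < x + 1 ∧ x + 1 < word σ (pos σ x + 1) := by
  rw [IsDoubleAscent, word_pos]

theorem isValley_pos (σ : Equiv.Perm (Fin n)) (x : Fin n) :
    IsValley σ (pos σ x) ↔ x + 1 < word σ (pos σ x - 1) ∧ x + 1 < word σ (pos σ x + 1) := by
  rw [IsValley, word_pos]

theorem forall_word_lt_iff (h : word σ (pos σ x - 1) < x + 1) :
    (∀ j ∈ Ico 1 (pos σ x), word σ j < word σ (pos σ x)) ↔ lesAt σ x = 0 := by
  rw [lesAt, descentsOver, card_eq_zero, filter_eq_empty_iff, word_pos]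
  refine ⟨fun hmax i hi hdesc => ?_, fun hnone j hj => ?_⟩
  · rw [mem_Icc] at hi
    rcases hi.1.eq_or_lt with rfl | hi'
    · simp [word_zero] at hdesc
    · exact lt_asymm hdesc.1 (hmax (i - 1) (mem_Ico.2 (by omega)))
  · by_contra hlt
    rw [mem_Ico] at hj
    have hj' := word_eq_iff σ j x
    obtain ⟨i, hji, hix, hpred, hi⟩ :=
      exists_pred_and_not_of_le (P := fun i => (x : ℕ) + 1 < word σ i) (a := j)
        (b := pos σ x - 1) (by omega) (by omega) h.not_gt
    have hi' := word_eq_iff σ i x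
    exact hnone (mem_Icc.2 ⟨by omega, by omega⟩) ⟨hpred, by omega⟩

theorem doubleAscentsAreForemaxima_iff (σ : Equiv.Perm (Fin n)) :
    DoubleAscentsAreForemaxima σ ↔ ∀ x, IsDoubleAscent σ (pos σ x) → lesAt σ x = 0 := by
  refine ⟨fun h x hx => ?_, fun h i hi hda => ?_⟩
  · exact (forall_word_lt_iff ((isDoubleAscent_pos σ x).1 hx).1).1 (h _ (pos_mem_Icc σ x) hx).2
  · obtain ⟨x, rfl⟩ := exists_pos_eq σ hi
    exact ⟨hda, (forall_word_lt_iff ((isDoubleAscent_pos σ x).1 hda).1).2 (h x hda)⟩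

theorem linearWeight_wordLetter {R : Type*} [CommSemiring R] (p q w y : R)
    (h : IsDoubleAscent σ (pos σ x) → lesAt σ x = 0) :
    linearWeight p q w y (cutDescents σ n x) (wordLetter σ x) =
      p ^ ressAt σ x * q ^ lesAt σ x * w ^ (if IsValley σ (pos σ x) then 1 else 0) *
        y ^ (if IsDoubleAscent σ (pos σ x) then 1 else 0) := by
  simp only [isDoubleAscent_pos, isValley_pos, cutDescents_last_eq] at h ⊢
  rcases wordLetter_cases σ x with ⟨hp, hs, hl⟩ | ⟨hp, hs, hl⟩ | ⟨hp, hs, hl⟩ | ⟨hp, hs, hl⟩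
  · simp [linearWeight, hl, hp, hs, hp.not_gt, hs.not_gt, mul_comm]
  · simp [linearWeight, hl, hp, hs, hp.not_gt, hs.not_gt, h ⟨hp, hs⟩, mul_comm]
  · simp [linearWeight, hl, hp, hs, hp.not_gt, hs.not_gt]
  · simp [linearWeight, hl, hp, hs, hp.not_gt, hs.not_gt]

theorem prod_linearWeight_wordLetter {R : Type*} [CommSemiring R] (p q w y : R)
    (σ : Equiv.Perm (Fin n)) :
    ∏ x : Fin n, linearWeight p q w y (cutDescents σ n x) (wordLetter σ x) =
      if DoubleAscentsAreForemaxima σ then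
        p ^ ress σ * q ^ les σ * w ^ valley σ * y ^ da σ else 0 := by
  split_ifs with h <;> rw [doubleAscentsAreForemaxima_iff] at h
  · rw [les_eq_sum, ress_eq_sum, valley, da]
    simp only [card_filter, sum_Icc_eq_sum_pos σ, ← prod_pow_eq_pow_sum, ← prod_mul_distrib]
    exact prod_congr rfl fun x _ => linearWeight_wordLetter p q w y (h x)
  · push Not at h
    obtain ⟨x, hda, hles⟩ := h
    rw [isDoubleAscent_pos] at hda
    refine prod_eq_zero (mem_univ x) ?_
    rw [wordLetter, if_neg hda.1.not_gt, if_pos hda.2, linearWeight, if_neg hles]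

theorem sum_doubleAscentsAreForemaxima_eq_motzkinSum {R : Type*} [CommSemiring R] (n : ℕ)
    (p q w y : R) :
    ∑ σ : Equiv.Perm (Fin n) with DoubleAscentsAreForemaxima σ,
        p ^ ress σ * q ^ les σ * w ^ valley σ * y ^ da σ =
      motzkinSum (fun h => w * pqNumber p q (h + 1)) (fun h => y * p ^ h + pqNumber p q h)
        (pqNumber p q) n 0 := by
  rw [sum_filter, ← totalWeight_wordSystem]
  simp only [← prod_linearWeight_wordLetter]
  refine (wordCoding n).sum_prod_eq_totalWeight _ ?_
  exact (totalWeight_wordSystem_one n).trans_le (by simp [Fintype.card_perm])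

end Weights

end LinearCoding

section Expansion

variable {R : Type*} [CommRing R] {n : ℕ}

theorem B_eq_B_one_zero (n : ℕ) (p q t u v w y : R) :
    B n p q t u v w y = B n p q 1 0 (q * u + t * v) (t * w) y := by
  rw [B_eq_motzkinSum, B_eq_motzkinSum, one_mul, mul_zero, zero_add, one_mul]

theorem B_one_zero (n : ℕ) (p q v w y : R) :
    B n p q 1 0 v w y = ∑ σ : Equiv.Perm (Fin n) with cda σ = 0,
      p ^ nest σ * q ^ cros σ * v ^ cdd σ * w ^ cvalley σ * y ^ fix σ := by
  rw [B, sum_filter]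
  refine sum_congr rfl fun σ _ => ?_
  split_ifs with h <;> simp [h]

theorem B_one_zero_one_eq_sum_doubleAscentsAreForemaxima (n : ℕ) (p q w y : R) :
    B n p q 1 0 1 w y = ∑ σ : Equiv.Perm (Fin n) with DoubleAscentsAreForemaxima σ,
      p ^ ress σ * q ^ les σ * w ^ valley σ * y ^ da σ := by
  rw [B_eq_motzkinSum, sum_doubleAscentsAreForemaxima_eq_motzkinSum]
  simp only [one_mul, mul_zero, zero_add]
  exact motzkinSum_zero_congr _ (fun h => by ring) n

open Polynomial in
theorem coeff_coeff_sum {S ι : Type*} [CommSemiring S] (s : Finset ι) (f g : S)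
    (m l c d : ι → ℕ) (k j : ℕ) :
    ((∑ i ∈ s, C (C f) ^ m i * C (C g) ^ l i * C X ^ c i * X ^ d i : S[X][X]).coeff j).coeff k =
      ∑ i ∈ s with c i = k ∧ d i = j, f ^ m i * g ^ l i := by
  rw [finsetSum_coeff, finsetSum_coeff, sum_filter]
  refine sum_congr rfl fun i _ => ?_
  simp only [← C_pow, ← C_mul, coeff_C_mul_X_pow, apply_ite (coeff · k), coeff_zero]
  grind

theorem b_eq_sum_cyclicClass (n k j : ℕ) :
    b n k j = ∑ σ ∈ cyclicClass n k j,
      MvPolynomial.X 0 ^ nest σ * MvPolynomial.X 1 ^ cros σ := by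
  simp only [b, B_one_zero, one_pow, mul_one]
  rw [coeff_coeff_sum, filter_filter, cyclicClass]
  exact sum_congr (filter_congr fun σ _ => by tauto) fun _ _ => rfl

theorem b_eq_sum_linearClass (n k j : ℕ) :
    b n k j = ∑ σ ∈ linearClass n k j,
      MvPolynomial.X 0 ^ ress σ * MvPolynomial.X 1 ^ les σ := by
  rw [b, B_one_zero_one_eq_sum_doubleAscentsAreForemaxima, coeff_coeff_sum, filter_filter,
    linearClass]
  exact sum_congr (filter_congr fun σ _ => by tauto) fun _ _ => rfl

theorem coeff_b_nonneg (n k j : ℕ) (m : Fin 2 →₀ ℕ) : 0 ≤ MvPolynomial.coeff m (b n k j) := by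
  classical
  rw [b_eq_sum_cyclicClass, MvPolynomial.coeff_sum]
  refine sum_nonneg fun σ _ => ?_
  rw [MvPolynomial.X_pow_eq_monomial, MvPolynomial.X_pow_eq_monomial, MvPolynomial.monomial_mul,
    MvPolynomial.coeff_monomial]
  split_ifs <;> simp

theorem aeval_b (p q : R) (n k j : ℕ) :
    MvPolynomial.aeval ![p, q] (b n k j) = ∑ σ ∈ cyclicClass n k j, p ^ nest σ * q ^ cros σ := by
  simp [b_eq_sum_cyclicClass]

theorem B_one_zero_eq_sum_aeval_b (n : ℕ) (p q v w y : R) :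
    B n p q 1 0 v w y = ∑ j ∈ range (n + 1), y ^ j * ∑ k ∈ range ((n - j) / 2 + 1),
      MvPolynomial.aeval ![p, q] (b n k j) * w ^ k * v ^ (n - j - 2 * k) := by
  have hdeg (σ : Equiv.Perm (Fin n)) := fix_add_two_mul_cvalley_add_cda_add_cdd σ
  rw [B_one_zero, ← sum_fiberwise_of_maps_to (t := range (n + 1)) (g := fix)
    fun σ _ => mem_range.2 (by have := hdeg σ; omega)]
  refine sum_congr rfl fun j _ => ?_
  rw [mul_sum, ← sum_fiberwise_of_maps_to (t := range ((n - j) / 2 + 1)) (g := cvalley)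
    fun σ hσ => mem_range.2 (by have := hdeg σ; have := (mem_filter.1 hσ).2; omega)]
  refine sum_congr rfl fun k _ => ?_
  rw [aeval_b, cyclicClass, sum_mul, sum_mul, mul_sum, filter_filter, filter_filter]
  refine sum_congr (filter_congr fun σ _ => by tauto) fun σ hσ => ?_
  obtain ⟨-, rfl, rfl, hcda⟩ := mem_filter.1 hσ
  rw [show n - fix σ - 2 * cvalley σ = cdd σ by have := hdeg σ; omega]
  ring

theorem derangementClass_eq (n k : ℕ) : derangementClass n k = cyclicClass n k 0 := by
  refine filter_congr fun σ _ => ?_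
  have hfix : σ ∈ derangements (Fin n) ↔ fix σ = 0 := by
    simp [derangements, fix, filter_eq_empty_iff]
  rw [hfix]
  tauto

theorem coderangementClass_eq (n k : ℕ) : coderangementClass n k = linearClass n k 0 := by
  refine filter_congr fun σ _ => ?_
  have hda (h : da σ = 0) : DoubleAscentsAreForemaxima σ ∧ fmax σ = 0 := by
    rw [da, card_eq_zero, filter_eq_empty_iff] at h
    exact ⟨fun i hi hi' => absurd hi' (h hi),
      card_eq_zero.2 (filter_eq_empty_iff.2 fun i hi hi' => h hi hi'.1)⟩
  tauto

end Expansion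

end PermStat

theorem mainTheorem3 (n : ℕ) :
    (∀ {R : Type*} [CommRing R] (p q t u v w y : R),
      PermStat.B n p q t u v w y =
        ∑ j ∈ Finset.range (n + 1), y ^ j *
          ∑ k ∈ Finset.range ((n - j) / 2 + 1),
            MvPolynomial.aeval ![p, q] (PermStat.b n k j) * (t * w) ^ k *
              (q * u + t * v) ^ (n - j - 2 * k)) ∧
    (∀ k j : ℕ,
      (∀ m, 0 ≤ MvPolynomial.coeff m (PermStat.b n k j)) ∧
      PermStat.b n k j = ∑ σ ∈ PermStat.cyclicClass n k j,
        MvPolynomial.X 0 ^ PermStat.nest σ * MvPolynomial.X 1 ^ PermStat.cros σ ∧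
      PermStat.b n k j = ∑ σ ∈ PermStat.linearClass n k j,
        MvPolynomial.X 0 ^ PermStat.ress σ * MvPolynomial.X 1 ^ PermStat.les σ) ∧
    (∀ k : ℕ,
      PermStat.b n k 0 = ∑ σ ∈ PermStat.derangementClass n k,
        MvPolynomial.X 0 ^ PermStat.nest σ * MvPolynomial.X 1 ^ PermStat.cros σ ∧
      PermStat.b n k 0 = ∑ σ ∈ PermStat.coderangementClass n k,
        MvPolynomial.X 0 ^ PermStat.ress σ * MvPolynomial.X 1 ^ PermStat.les σ) := by
  refine ⟨fun p q t u v w y => ?_, fun k j => ⟨PermStat.coeff_b_nonneg n k j,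
    PermStat.b_eq_sum_cyclicClass n k j, PermStat.b_eq_sum_linearClass n k j⟩, fun k => ⟨?_, ?_⟩⟩
  · rw [PermStat.B_eq_B_one_zero, PermStat.B_one_zero_eq_sum_aeval_b]
  · rw [PermStat.derangementClass_eq, PermStat.b_eq_sum_cyclicClass]
  · rw [PermStat.coderangementClass_eq, PermStat.b_eq_sum_linearClass]
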